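/- **Definitions.** All Hilbert spaces are finite-dimensional. An $r$-player nonlocal game $H$ consists of finite sets of input tuples $\mathcal I=\mathcal I_1\times\cdots\times\mathcal I_r$ and output tuples $\mathcal O=\mathcal O_1\times\cdots\times\mathcal O_r$, a probability distribution $p$ on $\mathcal I$, and a scoring function $L:\mathcal I\times\mathcal O\to\mathbb R$. The game $H^N$ has inputs $\mathbf u\in\mathcal I^N$ with distribution $\prod_j p(u_j)$, outputs $\mathbf t\in\mathcal O^N$, and score $\sum_{j=1}^N L(u_j,t_j)$. A measurement strategy on a Hilbert space $S$ is a family, indexed by inputs, of positive operator-valued measures on $S$ indexed by outputs. A measurement strategy $\{\{E_i^o\}_{o\in\mathcal O}\}_{i\in\mathcal I}$ on $S$ is $r$-partite if, under some unitary identification $S\cong Q_1\otimes\cdots\otimes Q_r$, $E_i^o=E_{1,i_1}^{o_1}\otimes\cdots\otimes E_{r,i_r}^{o_r}$ for all $i,o$, where $\{\{E_{k,i_k}^{o_k}\}_{o_k\in\mathcal O_k}\}_{i_k\in\mathcal I_k}$ is a measurement strategy on $Q_k$ for each $k$. The value $\omega(H)$ is the supremum, over all $r$-partite measurement strategies $\{\{E_i^o\}\}$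 and all density operators $\rho$ on $Q_1\otimes\cdots\otimes Q_r$, of the expected score $\sum_{i,o}p(i)\,\mathrm{Tr}(E_i^o\rho)\,L(i,o)$. Let $\mathbf F=\{\{F_{\mathbf u}^{\mathbf t}\}_{\mathbf t\in\mathcal O^N}\}_{\mathbf u\in\mathcal I^N}$ be a measurement strategy on $Q$. It is sequential if for all $0\le i\le N$ the operator $F_{\mathbf u}^{t_1\cdots t_i}:=\sum_{t_{i+1},\dots,t_N}F_{\mathbf u}^{t_1\cdots t_N}$ does not depend on $u_{i+1},\dots,u_N$; it is then written $F_{u_1\cdots u_i}^{t_1\cdots t_i}$. For $0\le i<N$ and $u_1,\dots,u_i,t_1,\dots,t_i$ with $A:=F_{u_1\cdots u_i}^{t_1\cdots t_i}\neq0$, the conditional strategy is the measurement strategy $\{\{A^{-1/2}F_{u_1\cdots u_{i+1}}^{t_1\cdots t_{i+1}}A^{-1/2}\}_{t_{i+1}}\}_{u_{i+1}}$ on the support of $A$, where $A^{-1/2}$ is the inverse on the support of $A$, extended by $0$. A sequential measurement strategy for $H^N$ is $r$-partite if all its conditional strategies are $r$-partite. **Proposition.** Let $r,N\ge 0$ be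 integers, let $K>0$ and $\delta\ge0$ be real numbers, let $H$ be an $r$-player nonlocal game whose scoring function takes values in $[-K,K]$, let $\mathbf F$ be an $r$-partite sequential measurement strategy for $H^N$ on a Hilbert space $Q$, and let $\phi$ be a density operator on $Q$. Let $(\mathbf u,\mathbf t)$ have joint probability $\prod_j p(u_j)\cdot\mathrm{Tr}(F_{\mathbf u}^{\mathbf t}\phi)$. Then $$\Pr\Big[\sum_{j=1}^N L(u_j,t_j)>(\omega(H)+\delta)N\Big]\le \exp\!\Big(-\frac{N\delta^2}{8K^2}\Big).$$ -/

import Mathlib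

open scoped Matrix BigOperators ComplexOrder

noncomputable section

/-- A finite game: a probability distribution on inputs `U` and a real score on input/output
pairs. -/
structure Game (U T : Type*) [Fintype U] where
  dist : U → ℝ
  dist_nonneg : ∀ u, 0 ≤ dist u
  dist_sum : ∑ u, dist u = 1
  score : U → T → ℝ

/-- An `r`-player nonlocal game: inputs and outputs are tuples, player `k` having input
alphabet `I k` and output alphabet `O k`. -/
abbrev NonlocalGame {r : ℕ} (I O : Fin r → Type*) [∀ k, Fintype (I k)] :=
  Game (∀ k, I k) (∀ k, O k)

/-- The `N`-fold direct product `H ^ N`: independent inputs, and the score is the sum of the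
scores. -/
def Game.repeated {U T : Type*} [Fintype U] (H : Game U T) (N : ℕ) :
    Game (Fin N → U) (Fin N → T) where
  dist u := ∏ j, H.dist (u j)
  dist_nonneg u := Finset.prod_nonneg fun j _ => H.dist_nonneg (u j)
  dist_sum := by
    have h := (Finset.prod_univ_sum (fun _ : Fin N => (Finset.univ : Finset U))
      (fun _ u => H.dist u)).symm
    rw [Fintype.piFinset_univ] at h
    rw [h]
    simp [H.dist_sum]
  score u t := ∑ j, H.score (u j) (t j)

/-- Density operators on the register with orthonormal basis `Q`. -/
def IsState {Q : Type*} [Fintype Q] (φ : Matrix Q Q ℂ) : Prop :=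
  φ.PosSemidef ∧ φ.trace = 1

/-- A measurement strategy on the register `Q`: for each input a positive operator-valued
measure on `Q`. -/
def IsMeasurementStrategy {Q U T : Type*} [DecidableEq Q] [Fintype T]
    (F : U → T → Matrix Q Q ℂ) : Prop :=
  (∀ u t, (F u t).PosSemidef) ∧ ∀ u, ∑ t, F u t = 1

/-- The expected score of the strategy `(F, φ)`. -/
def Game.expectedScore {U T Q : Type*} [Fintype U] [Fintype T] [Fintype Q]
    (G : Game U T) (F : U → T → Matrix Q Q ℂ) (φ : Matrix Q Q ℂ) : ℝ :=
  ∑ u, ∑ t, G.dist u * (F u t * φ).trace.re * G.score u t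

open Classical in
/-- The probability that the score of the strategy `(F, φ)` exceeds `c`. -/
def Game.probScoreExceeds {U T Q : Type*} [Fintype U] [Fintype T] [Fintype Q]
    (G : Game U T) (F : U → T → Matrix Q Q ℂ) (φ : Matrix Q Q ℂ) (c : ℝ) : ℝ :=
  ∑ u, ∑ t with c < G.score u t, G.dist u * (F u t * φ).trace.re

/-- The strategy `F_{1, i_1}^{o_1} ⊗ ⋯ ⊗ F_{r, i_r}^{o_r}` on the register `Q_1 ⊗ ⋯ ⊗ Q_r`,
whose basis is the product of the bases of the `Q_k`. -/
def productStrategy {r : ℕ} {I O D : Fin r → Type*}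
    (F : ∀ k, I k → O k → Matrix (D k) (D k) ℂ) (u : ∀ k, I k) (t : ∀ k, O k) :
    Matrix (∀ k, D k) (∀ k, D k) ℂ :=
  Matrix.of fun x y => ∏ k, F k (u k) (t k) (x k) (y k)

/-- The quantum value: the supremum of the expected score over all `r`-partite quantum strategies
(on arbitrary finite-dimensional registers `Q_1, …, Q_r`). -/
def quantumValue {r : ℕ} {I O : Fin r → Type*} [∀ k, Fintype (I k)] [∀ k, Fintype (O k)]
    (H : NonlocalGame I O) : ℝ :=
  sSup {x | ∃ (d : Fin r → ℕ) (F : ∀ k, I k → O k → Matrix (Fin (d k)) (Fin (d k)) ℂ)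
    (φ : Matrix (∀ k, Fin (d k)) (∀ k, Fin (d k)) ℂ),
    (∀ k, IsMeasurementStrategy (F k)) ∧ IsState φ ∧
      x = H.expectedScore (productStrategy F) φ}

/-- `E`, a measurement strategy on a subspace `S` of the register `Q` (extended by zero on the
orthogonal complement of `S`), is `r`-partite: `S` is identified, by an isometry `V` onto it, with
a tensor product `Q_1 ⊗ ⋯ ⊗ Q_r`, and under this identification `E` is a product strategy.
The equation forces `∑ t, E u t = V * Vᴴ`, so `S` is the whole of `Q` if the `E u t` add up
to `1`. -/
def IsPartite {r : ℕ} {I O : Fin r → Type*} [∀ k, Fintype (O k)] {Q : Type*} [Fintype Q]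
    (E : (∀ k, I k) → (∀ k, O k) → Matrix Q Q ℂ) : Prop :=
  ∃ (d : Fin r → ℕ) (F : ∀ k, I k → O k → Matrix (Fin (d k)) (Fin (d k)) ℂ)
    (V : Matrix Q (∀ k, Fin (d k)) ℂ),
    (∀ k, IsMeasurementStrategy (F k)) ∧ Vᴴ * V = 1 ∧
      ∀ u t, E u t = V * productStrategy F u t * Vᴴ

open Classical in
/-- The operator `F_u^{t_1 ⋯ t_i}`: the sum of `F_u^s` over all output sequences `s` whose first
`i` entries are those of `t`. -/
def prefixOp {N : ℕ} {U T Q : Type*} [Fintype T] (F : (Fin N → U) → (Fin N → T) → Matrix Q Q ℂ)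
    (i : ℕ) (u : Fin N → U) (t : Fin N → T) : Matrix Q Q ℂ :=
  ∑ s with ∀ j : Fin N, (j : ℕ) < i → s j = t j, F u s

/-- A strategy is sequential if `F_u^{t_1 ⋯ t_i}` does not depend on the inputs after the
`i`-th. -/
def IsSequential {N : ℕ} {U T Q : Type*} [Fintype T]
    (F : (Fin N → U) → (Fin N → T) → Matrix Q Q ℂ) : Prop :=
  ∀ i ≤ N, ∀ (u u' : Fin N → U) (t : Fin N → T),
    (∀ j : Fin N, (j : ℕ) < i → u j = u' j) → prefixOp F i u t = prefixOp F i u' t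

/-- `A ^ (-1/2)` for a positive semidefinite `A`, taken on the support of `A` and extended by zero
(the function `x ↦ (√x)⁻¹` vanishes at `0`). -/
def invSqrt {Q : Type*} [Fintype Q] [DecidableEq Q] (A : Matrix Q Q ℂ) : Matrix Q Q ℂ :=
  cfc (fun x : ℝ => (√x)⁻¹) A

/-- The conditional strategy for round `i` (rounds are numbered from `0`), given the inputs
`u j` and outputs `t j` of the rounds `j < i`. It is a measurement strategy on the support of
`prefixOp F i u t`; the entries of `u` and `t` from `i` on are irrelevant for sequential `F`. -/
def conditionalStrategy {N : ℕ} {U T Q : Type*} [Fintype T] [Fintype Q] [DecidableEq Q]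
    (F : (Fin N → U) → (Fin N → T) → Matrix Q Q ℂ) (i : Fin N) (u : Fin N → U) (t : Fin N → T)
    (v : U) (s : T) : Matrix Q Q ℂ :=
  invSqrt (prefixOp F i u t) *
    prefixOp F (i + 1) (Function.update u i v) (Function.update t i s) *
    invSqrt (prefixOp F i u t)

/-- An `r`-partite sequential measurement strategy for the `N`-fold repetition of a game. -/
structure IsPartiteSequentialStrategy {r N : ℕ} {I O : Fin r → Type*} [∀ k, Fintype (O k)]
    {Q : Type*} [Fintype Q] [DecidableEq Q]
    (F : (Fin N → ∀ k, I k) → (Fin N → ∀ k, O k) → Matrix Q Q ℂ) : Prop where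
  measurement : IsMeasurementStrategy F
  sequential : IsSequential F
  partite : ∀ (i : Fin N) (u : Fin N → ∀ k, I k) (t : Fin N → ∀ k, O k),
    prefixOp F i u t ≠ 0 → IsPartite (conditionalStrategy F i u t)

end

/-! ### Positive semidefinite matrices -/

/-! Fix a history with prefix operator `A`. Playing the next round of `F` on `φ` gives the same
statistics as playing the conditional strategy on the unnormalized state `√A φ √A`
(`sqrt_mul_invSqrt_conj`). That strategy is `r`-partite, so the mean score of the round given the
history is at most the value `ω` (`conditional_expectedScore_le`). Hence the partial sums of `L - ω`
form a supermartingale with increments bounded by `2K`. The Azuma-Hoeffding argument bounds their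
exponential moment by `cosh (2Kλ) ^ N` (`sum_prod_mul_exp_le`), and exponential Markov
(`Game.probScoreExceeds_le`) with the best `λ` concludes. Unnormalized weights replace conditional
probabilities throughout, so histories of probability zero need no separate treatment in the moment
argument. -/

open scoped MatrixOrder Matrix.Norms.L2Operator in
theorem Matrix.PosSemidef.exists_eq_conjTranspose_mul_self {n : Type*} [Fintype n]
    {A : Matrix n n ℂ} (hA : A.PosSemidef) : ∃ C : Matrix n n ℂ, A = Cᴴ * C := by
  classical
  exact CStarAlgebra.nonneg_iff_eq_star_mul_self.mp hA.nonneg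

theorem Matrix.PosSemidef.trace_mul_nonneg {n : Type*} [Fintype n] {A B : Matrix n n ℂ}
    (hA : A.PosSemidef) (hB : B.PosSemidef) : 0 ≤ (A * B).trace := by
  obtain ⟨C, rfl⟩ := hA.exists_eq_conjTranspose_mul_self
  rw [Matrix.mul_assoc, Matrix.trace_mul_comm]
  exact (hB.mul_mul_conjTranspose_same C).trace_nonneg

theorem Matrix.PosSemidef.trace_mul_re_nonneg {n : Type*} [Fintype n] {A B : Matrix n n ℂ}
    (hA : A.PosSemidef) (hB : B.PosSemidef) : 0 ≤ (A * B).trace.re :=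
  (Complex.le_def.mp (hA.trace_mul_nonneg hB)).1

theorem Matrix.PosSemidef.eq_zero_of_trace_eq_zero {n : Type*} [Fintype n] {A : Matrix n n ℂ}
    (hA : A.PosSemidef) (h : A.trace = 0) : A = 0 := by
  obtain ⟨C, rfl⟩ := hA.exists_eq_conjTranspose_mul_self
  rw [Matrix.trace_conjTranspose_mul_self_eq_zero_iff] at h
  simp [h]

theorem Matrix.PosSemidef.eq_zero_of_sum_eq_zero {n ι : Type*} [Fintype n] [Fintype ι]
    {A : ι → Matrix n n ℂ} (hA : ∀ i, (A i).PosSemidef) (h : ∑ i, A i = 0) (i : ι) : A i = 0 := by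
  refine (hA i).eq_zero_of_trace_eq_zero ?_
  have ht : ∑ i, (A i).trace = 0 := by rw [← Matrix.trace_sum, h, Matrix.trace_zero]
  exact (Finset.sum_eq_zero_iff_of_nonneg fun i _ => (hA i).trace_nonneg).mp ht i (Finset.mem_univ i)

theorem Matrix.PosSemidef.mul_eq_zero_of_conj_eq_zero {n m : Type*} [Fintype n] [Fintype m]
    {A : Matrix n n ℂ} (hA : A.PosSemidef) {P : Matrix n m ℂ} (h : Pᴴ * A * P = 0) :
    A * P = 0 := by
  obtain ⟨C, rfl⟩ := hA.exists_eq_conjTranspose_mul_self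
  have : C * P = 0 := by
    rw [← Matrix.conjTranspose_mul_self_eq_zero, Matrix.conjTranspose_mul, ← h]
    simp only [Matrix.mul_assoc]
  rw [Matrix.mul_assoc, this, Matrix.mul_zero]

theorem Matrix.cfc_mul_cfc {n : Type*} [Fintype n] [DecidableEq n] (A : Matrix n n ℂ)
    (f g : ℝ → ℝ) : cfc f A * cfc g A = cfc (fun x => f x * g x) A :=
  (cfc_mul f g A (A.finite_real_spectrum.continuousOn f) (A.finite_real_spectrum.continuousOn g)).symm

/-- The positive square root and `invSqrt` recover every positive operator dominated by `A`. -/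
theorem sqrt_mul_invSqrt_conj {Q ι : Type*} [Fintype Q] [DecidableEq Q] [Fintype ι]
    {A : Matrix Q Q ℂ} {B : ι → Matrix Q Q ℂ} (hB : ∀ s, (B s).PosSemidef) (hsum : ∑ s, B s = A)
    (s : ι) :
    cfc Real.sqrt A * (invSqrt A * B s * invSqrt A) * cfc Real.sqrt A = B s := by
  have hA : A.PosSemidef := hsum ▸ Matrix.posSemidef_sum _ fun s _ => hB s
  -- `R` is the projection onto the support of `A`: `√x * (√x)⁻¹` is `1` for `x > 0` and `0` at `0`.
  set R : Matrix Q Q ℂ := cfc (fun x : ℝ => √x * (√x)⁻¹) A with hR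
  have hRh : Rᴴ = R := (cfc_predicate (fun x : ℝ => √x * (√x)⁻¹) A : IsSelfAdjoint _)
  have h1 : cfc Real.sqrt A * invSqrt A = R := Matrix.cfc_mul_cfc A _ _
  have h2 : invSqrt A * cfc Real.sqrt A = R := by
    rw [hR, invSqrt, Matrix.cfc_mul_cfc]; simp only [mul_comm]
  have hAR : A * R = A := by
    conv_lhs => enter [1]; rw [← cfc_id ℝ A hA.isHermitian.isSelfAdjoint]
    conv_rhs => rw [← cfc_id ℝ A hA.isHermitian.isSelfAdjoint]
    rw [hR, Matrix.cfc_mul_cfc]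
    refine cfc_congr fun x hx => ?_
    rw [hA.isHermitian.spectrum_real_eq_range_eigenvalues] at hx
    have hx0 : 0 ≤ x := by
      obtain ⟨j, rfl⟩ := hx
      exact hA.eigenvalues_nonneg j
    rcases hx0.eq_or_lt with rfl | hx0
    · simp
    · have : √x ≠ 0 := (Real.sqrt_pos.mpr hx0).ne'
      simp [this]
  -- The compression of `A` to the complement of its support vanishes, hence so does that of each
  -- positive summand `B s`.
  have hz : ∑ s, (1 - R)ᴴ * B s * (1 - R) = 0 := by
    rw [← Finset.sum_mul, ← Finset.mul_sum, hsum, Matrix.mul_assoc, Matrix.mul_sub, hAR]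
    simp
  have hBR : B s * R = B s := by
    have := (hB s).mul_eq_zero_of_conj_eq_zero
      (Matrix.PosSemidef.eq_zero_of_sum_eq_zero
        (fun s => (hB s).conjTranspose_mul_mul_same (1 - R)) hz s)
    rw [Matrix.mul_sub, Matrix.mul_one, sub_eq_zero] at this
    exact this.symm
  have hRB : R * B s = B s := by
    have := congrArg Matrix.conjTranspose hBR
    rwa [Matrix.conjTranspose_mul, hRh, (hB s).isHermitian.eq] at this
  calc _ = (cfc Real.sqrt A * invSqrt A) * B s * (invSqrt A * cfc Real.sqrt A) := by
        simp only [Matrix.mul_assoc]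
    _ = B s := by rw [h1, h2, hRB, hBR]

/-! ### The quantum value -/

/-- The tensor product of a family of matrices. -/
def tensorMatrix {r : ℕ} {D : Fin r → Type*} (C : ∀ k, Matrix (D k) (D k) ℂ) :
    Matrix (∀ k, D k) (∀ k, D k) ℂ :=
  Matrix.of fun x y => ∏ k, C k (x k) (y k)

theorem tensorMatrix_mul {r : ℕ} {D : Fin r → Type*} [∀ k, Fintype (D k)]
    (A B : ∀ k, Matrix (D k) (D k) ℂ) :
    tensorMatrix A * tensorMatrix B = tensorMatrix fun k => A k * B k := by
  ext x y
  simp only [tensorMatrix, Matrix.mul_apply, Matrix.of_apply, ← Finset.prod_mul_distrib]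
  exact (Fintype.prod_sum fun k z => A k (x k) z * B k z (y k)).symm

theorem tensorMatrix_conjTranspose {r : ℕ} {D : Fin r → Type*} (A : ∀ k, Matrix (D k) (D k) ℂ) :
    (tensorMatrix A)ᴴ = tensorMatrix fun k => (A k)ᴴ := by
  ext x y
  simp [tensorMatrix, Matrix.conjTranspose_apply]

theorem isMeasurementStrategy_productStrategy {r : ℕ} {I O D : Fin r → Type*}
    [∀ k, Fintype (O k)] [∀ k, Fintype (D k)] [∀ k, DecidableEq (D k)]
    {F : ∀ k, I k → O k → Matrix (D k) (D k) ℂ} (hF : ∀ k, IsMeasurementStrategy (F k)) :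
    IsMeasurementStrategy (productStrategy F) := by
  constructor
  · intro u t
    choose C hC using fun k => ((hF k).1 (u k) (t k)).exists_eq_conjTranspose_mul_self
    have : productStrategy F u t = (tensorMatrix C)ᴴ * tensorMatrix C := by
      rw [tensorMatrix_conjTranspose, tensorMatrix_mul]
      ext x y
      simp [productStrategy, tensorMatrix, hC]
    rw [this]
    exact Matrix.posSemidef_conjTranspose_mul_self _
  · intro u
    ext x y
    have h : ∀ k, ∑ o, F k (u k) o (x k) (y k) = (1 : Matrix (D k) (D k) ℂ) (x k) (y k) := by
      intro k
      rw [← (hF k).2 (u k), Matrix.sum_apply]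
    simp only [Matrix.sum_apply, productStrategy, Matrix.of_apply]
    rw [← Fintype.prod_sum fun k o => F k (u k) o (x k) (y k)]
    simp only [h, Matrix.one_apply, Finset.prod_ite_zero, funext_iff]
    simp

theorem Game.abs_expectedScore_le {U T Q : Type*} [Fintype U] [Fintype T] [Fintype Q]
    [DecidableEq Q] (G : Game U T) {K : ℝ} (hK : ∀ u t, G.score u t ∈ Set.Icc (-K) K)
    {F : U → T → Matrix Q Q ℂ} (hF : IsMeasurementStrategy F) {φ : Matrix Q Q ℂ}
    (hφ : IsState φ) : |G.expectedScore F φ| ≤ K := by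
  have hw : ∀ u, ∑ t, (F u t * φ).trace.re = 1 := by
    intro u
    rw [← Complex.re_sum, ← Matrix.trace_sum, ← Finset.sum_mul, hF.2 u, Matrix.one_mul, hφ.2]
    simp
  have hn : ∀ u t, 0 ≤ G.dist u * (F u t * φ).trace.re := fun u t =>
    mul_nonneg (G.dist_nonneg u) ((hF.1 u t).trace_mul_re_nonneg hφ.1)
  calc |G.expectedScore F φ| ≤ ∑ u, ∑ t, |G.dist u * (F u t * φ).trace.re * G.score u t| :=
        (Finset.abs_sum_le_sum_abs _ _).trans
          (Finset.sum_le_sum fun u _ => Finset.abs_sum_le_sum_abs _ _)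
    _ ≤ ∑ u, ∑ t, G.dist u * (F u t * φ).trace.re * K := by
        refine Finset.sum_le_sum fun u _ => Finset.sum_le_sum fun t _ => ?_
        rw [abs_mul, abs_of_nonneg (hn u t)]
        exact mul_le_mul_of_nonneg_left (abs_le.mpr (hK u t)) (hn u t)
    _ = K := by
        simp only [← Finset.sum_mul, ← Finset.mul_sum, hw, mul_one, G.dist_sum, one_mul]

theorem expectedScore_le_quantumValue {r : ℕ} {I O : Fin r → Type*} [∀ k, Fintype (I k)]
    [∀ k, Fintype (O k)] (H : NonlocalGame I O) {K : ℝ}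
    (hscore : ∀ u t, H.score u t ∈ Set.Icc (-K) K) {d : Fin r → ℕ}
    {F : ∀ k, I k → O k → Matrix (Fin (d k)) (Fin (d k)) ℂ}
    {φ : Matrix (∀ k, Fin (d k)) (∀ k, Fin (d k)) ℂ} (hF : ∀ k, IsMeasurementStrategy (F k))
    (hφ : IsState φ) : H.expectedScore (productStrategy F) φ ≤ quantumValue H := by
  refine le_csSup ⟨K, ?_⟩ ⟨d, F, φ, hF, hφ, rfl⟩
  rintro x ⟨d, F, φ, hF, hφ, rfl⟩
  exact (abs_le.mp (H.abs_expectedScore_le hscore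
    (isMeasurementStrategy_productStrategy hF) hφ)).2

theorem abs_quantumValue_le {r : ℕ} {I O : Fin r → Type*} [∀ k, Fintype (I k)]
    [∀ k, Fintype (O k)] (H : NonlocalGame I O) {K : ℝ}
    (hscore : ∀ u t, H.score u t ∈ Set.Icc (-K) K) (hK : 0 ≤ K) : |quantumValue H| ≤ K := by
  rw [abs_le]
  -- There may be no strategy at all: an empty output alphabet forces `0 = 1` on that player's
  -- register, leaving no state. The real supremum is then `0`, still in `[-K, K]`.
  rcases Set.eq_empty_or_nonempty {x | ∃ (d : Fin r → ℕ)
    (F : ∀ k, I k → O k → Matrix (Fin (d k)) (Fin (d k)) ℂ)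
    (φ : Matrix (∀ k, Fin (d k)) (∀ k, Fin (d k)) ℂ),
    (∀ k, IsMeasurementStrategy (F k)) ∧ IsState φ ∧
      x = H.expectedScore (productStrategy F) φ} with he | ⟨x, hx⟩
  · rw [quantumValue, he, Real.sSup_empty]
    exact ⟨neg_nonpos.mpr hK, hK⟩
  · refine ⟨?_, csSup_le ⟨x, hx⟩ ?_⟩
    · obtain ⟨d, F, φ, hF, hφ, rfl⟩ := hx
      exact (abs_le.mp (H.abs_expectedScore_le hscore
        (isMeasurementStrategy_productStrategy hF) hφ)).1.trans
        (expectedScore_le_quantumValue H hscore hF hφ)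
    · rintro x ⟨d, F, φ, hF, hφ, rfl⟩
      exact (abs_le.mp (H.abs_expectedScore_le hscore
        (isMeasurementStrategy_productStrategy hF) hφ)).2

/-- The bound by the quantum value for unnormalized states. -/
theorem expectedScore_le_quantumValue_mul_trace {r : ℕ} {I O : Fin r → Type*} [∀ k, Fintype (I k)]
    [∀ k, Fintype (O k)] (H : NonlocalGame I O) {K : ℝ}
    (hscore : ∀ u t, H.score u t ∈ Set.Icc (-K) K) {d : Fin r → ℕ}
    {F : ∀ k, I k → O k → Matrix (Fin (d k)) (Fin (d k)) ℂ}
    {σ : Matrix (∀ k, Fin (d k)) (∀ k, Fin (d k)) ℂ} (hF : ∀ k, IsMeasurementStrategy (F k))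
    (hσ : σ.PosSemidef) :
    H.expectedScore (productStrategy F) σ ≤ quantumValue H * σ.trace.re := by
  obtain ⟨hre, him⟩ := Complex.le_def.mp hσ.trace_nonneg
  simp only [Complex.zero_re, Complex.zero_im] at hre him
  have htr : σ.trace = (σ.trace.re : ℂ) := Complex.ext rfl (by simp [← him])
  rcases hre.eq_or_lt with h0 | hpos
  · have : σ = 0 := hσ.eq_zero_of_trace_eq_zero (by rw [htr, ← h0]; simp)
    simp [this, Game.expectedScore]
  set c := σ.trace.re with hc
  have hstate : IsState (((c⁻¹ : ℝ) : ℂ) • σ) := by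
    refine ⟨hσ.smul ?_, ?_⟩
    · exact_mod_cast inv_nonneg.mpr hre
    · rw [Matrix.trace_smul, htr, smul_eq_mul, ← Complex.ofReal_mul, inv_mul_cancel₀ hpos.ne']
      simp
  have hle := expectedScore_le_quantumValue H hscore hF hstate
  have heq : H.expectedScore (productStrategy F) (((c⁻¹ : ℝ) : ℂ) • σ) =
      c⁻¹ * H.expectedScore (productStrategy F) σ := by
    simp only [Game.expectedScore, Matrix.mul_smul, Matrix.trace_smul, smul_eq_mul,
      Complex.re_ofReal_mul, Finset.mul_sum]
    refine Finset.sum_congr rfl fun u _ => Finset.sum_congr rfl fun t _ => by ring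
  rw [heq, inv_mul_le_iff₀ hpos] at hle
  linarith

/-! ### Exponential moments of sums of bounded variables with nonpositive conditional mean -/

/-- The convex function `exp` lies below its chord over `[-lam * c, lam * c]`. The bound is affine
in `y`, so averaging it involves only the mean of `y`. -/
theorem Real.exp_mul_le_cosh_add_sinh {lam y c : ℝ} (hc : 0 < c) (hy : |y| ≤ c) :
    Real.exp (lam * y) ≤ Real.cosh (lam * c) + y * (Real.sinh (lam * c) / c) := by
  obtain ⟨h1, h2⟩ := abs_le.mp hy
  have h := convexOn_exp.2 (Set.mem_univ (lam * c)) (Set.mem_univ (-(lam * c)))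
    (show 0 ≤ (c + y) / (2 * c) from div_nonneg (by linarith) (by linarith))
    (show 0 ≤ (c - y) / (2 * c) from div_nonneg (by linarith) (by linarith))
    (by field_simp; ring)
  simp only [smul_eq_mul] at h
  calc Real.exp (lam * y)
      = Real.exp ((c + y) / (2 * c) * (lam * c) + (c - y) / (2 * c) * -(lam * c)) := by
        congr 1; field_simp; ring
    _ ≤ _ := h
    _ = _ := by rw [Real.cosh_eq, Real.sinh_eq]; field_simp; ring

/-- `G i u t` is the probability of seeing the outputs `t` in the first `i` rounds when the inputs
are `u`. -/
theorem sum_prod_mul_exp_le {U T : Type*} [Fintype U] [Fintype T] {p : U → ℝ}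
    (hp : ∀ u, 0 ≤ p u) (hp1 : ∑ u, p u = 1) {Y : U → T → ℝ} {c : ℝ} (hc : 0 < c)
    (hY : ∀ u t, |Y u t| ≤ c) {N : ℕ} {G : (i : ℕ) → (Fin i → U) → (Fin i → T) → ℝ}
    (hG : ∀ i ≤ N, ∀ u t, 0 ≤ G i u t)
    (hsum : ∀ i < N, ∀ u t v, ∑ s, G (i + 1) (Fin.snoc u v) (Fin.snoc t s) = G i u t)
    (hmean : ∀ i < N, ∀ u t,
      ∑ v, ∑ s, p v * G (i + 1) (Fin.snoc u v) (Fin.snoc t s) * Y v s ≤ 0)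
    {lam : ℝ} (hlam : 0 ≤ lam) {i : ℕ} (hi : i ≤ N) :
    ∑ u, ∑ t, (∏ j, p (u j)) * G i u t * Real.exp (lam * ∑ j, Y (u j) (t j)) ≤
      Real.cosh (lam * c) ^ i * G 0 Fin.elim0 Fin.elim0 := by
  induction i with
  | zero =>
    rw [Fintype.sum_unique, Fintype.sum_unique]
    simp [Subsingleton.elim (default : Fin 0 → U) Fin.elim0,
      Subsingleton.elim (default : Fin 0 → T) Fin.elim0]
  | succ i ih =>
    have hround : ∀ u t, ∑ v, ∑ s, p v * G (i + 1) (Fin.snoc u v) (Fin.snoc t s) *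
        Real.exp (lam * Y v s) ≤ Real.cosh (lam * c) * G i u t := by
      intro u t
      -- The slope of the chord is nonnegative because `lam` is, so a nonpositive conditional mean
      -- allows the linear term to be dropped.
      have hs : 0 ≤ Real.sinh (lam * c) / c :=
        div_nonneg (Real.sinh_nonneg_iff.mpr (mul_nonneg hlam hc.le)) hc.le
      calc _ ≤ ∑ v, ∑ s, p v * G (i + 1) (Fin.snoc u v) (Fin.snoc t s) *
            (Real.cosh (lam * c) + Y v s * (Real.sinh (lam * c) / c)) :=
            Finset.sum_le_sum fun v _ => Finset.sum_le_sum fun s _ =>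
              mul_le_mul_of_nonneg_left (Real.exp_mul_le_cosh_add_sinh hc (hY v s))
                (mul_nonneg (hp v) (hG _ hi _ _))
        _ = (∑ v, p v * ∑ s, G (i + 1) (Fin.snoc u v) (Fin.snoc t s)) * Real.cosh (lam * c) +
            (∑ v, ∑ s, p v * G (i + 1) (Fin.snoc u v) (Fin.snoc t s) * Y v s) *
              (Real.sinh (lam * c) / c) := by
            simp only [Finset.sum_mul, Finset.mul_sum, mul_add, Finset.sum_add_distrib, mul_assoc]
        _ ≤ _ := by
            simp only [hsum i hi, ← Finset.sum_mul, hp1, one_mul]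
            nlinarith [mul_nonpos_of_nonpos_of_nonneg (hmean i hi u t) hs]
    calc _ = ∑ u : Fin i → U, ∑ t : Fin i → T,
          (∏ j, p (u j)) * Real.exp (lam * ∑ j, Y (u j) (t j)) *
            ∑ v, ∑ s, p v * G (i + 1) (Fin.snoc u v) (Fin.snoc t s) * Real.exp (lam * Y v s) := by
          -- Splitting off the last entry of both sequences factors the exponential into past and
          -- current round.
          rw [← (Fin.snocEquiv fun _ : Fin (i + 1) => U).sum_comp, Fintype.sum_prod_type_right]
          refine Finset.sum_congr rfl fun u _ => ?_
          simp only [Finset.mul_sum]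
          conv_rhs => rw [Finset.sum_comm]
          refine Finset.sum_congr rfl fun v _ => ?_
          rw [← (Fin.snocEquiv fun _ : Fin (i + 1) => T).sum_comp, Fintype.sum_prod_type_right]
          refine Finset.sum_congr rfl fun t _ => Finset.sum_congr rfl fun s _ => ?_
          rw [show Fin.snocEquiv (fun _ : Fin (i + 1) => U) (v, u) = Fin.snoc u v from rfl,
            show Fin.snocEquiv (fun _ : Fin (i + 1) => T) (s, t) = Fin.snoc t s from rfl]
          simp only [Fin.prod_univ_castSucc, Fin.sum_univ_castSucc, Fin.snoc_castSucc,
            Fin.snoc_last, Real.exp_add]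
          ring
      _ ≤ ∑ u : Fin i → U, ∑ t : Fin i → T,
          (∏ j, p (u j)) * Real.exp (lam * ∑ j, Y (u j) (t j)) *
            (Real.cosh (lam * c) * G i u t) :=
          Finset.sum_le_sum fun u _ => Finset.sum_le_sum fun t _ =>
            mul_le_mul_of_nonneg_left (hround u t)
              (mul_nonneg (Finset.prod_nonneg fun j _ => hp _) (Real.exp_nonneg _))
      _ = Real.cosh (lam * c) * ∑ u : Fin i → U, ∑ t : Fin i → T,
          (∏ j, p (u j)) * G i u t * Real.exp (lam * ∑ j, Y (u j) (t j)) := by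
          simp only [Finset.mul_sum]
          refine Finset.sum_congr rfl fun u _ => Finset.sum_congr rfl fun t _ => by ring
      _ ≤ _ := by
          rw [pow_succ', mul_assoc]
          exact mul_le_mul_of_nonneg_left (ih (by omega)) (Real.cosh_pos _).le

/-! ### Prefix operators -/

theorem posSemidef_prefixOp {N : ℕ} {U T Q : Type*} [Fintype T] [Fintype Q] [DecidableEq Q]
    {F : (Fin N → U) → (Fin N → T) → Matrix Q Q ℂ} (hF : IsMeasurementStrategy F) (i : ℕ)
    (u : Fin N → U) (t : Fin N → T) : (prefixOp F i u t).PosSemidef :=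
  Matrix.posSemidef_sum _ fun s _ => hF.1 u s

theorem prefixOp_zero {N : ℕ} {U T Q : Type*} [Fintype T]
    (F : (Fin N → U) → (Fin N → T) → Matrix Q Q ℂ) (u : Fin N → U) (t : Fin N → T) :
    prefixOp F 0 u t = ∑ s, F u s := by
  simp [prefixOp]

theorem prefixOp_self {N : ℕ} {U T Q : Type*} [Fintype T]
    (F : (Fin N → U) → (Fin N → T) → Matrix Q Q ℂ) (u : Fin N → U) (t : Fin N → T) :
    prefixOp F N u t = F u t := by
  classical
  simp [prefixOp, ← funext_iff, Finset.filter_eq']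

theorem sum_prefixOp_succ {N : ℕ} {U T Q : Type*} [Fintype T]
    (F : (Fin N → U) → (Fin N → T) → Matrix Q Q ℂ) (i : Fin N) (u : Fin N → U) (t : Fin N → T) :
    ∑ s, prefixOp F (i + 1) u (Function.update t i s) = prefixOp F i u t := by
  classical
  simp only [prefixOp, Finset.sum_filter]
  rw [Finset.sum_comm]
  refine Finset.sum_congr rfl fun w _ => ?_
  -- A full output sequence `w` is counted only for `s = w i`, so the sum over `s` collapses.
  have key : ∀ s, (∀ j : Fin N, (j : ℕ) < i + 1 → w j = Function.update t i s j) ↔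
      s = w i ∧ ∀ j : Fin N, (j : ℕ) < i → w j = t j := by
    intro s
    constructor
    · intro h
      refine ⟨by simpa using (h i (Nat.lt_succ_self _)).symm, fun j hj => ?_⟩
      have := h j (by omega)
      rwa [Function.update_of_ne (by rintro rfl; omega)] at this
    · rintro ⟨rfl, h⟩ j hj
      by_cases hji : j = i
      · subst hji; simp
      · rw [Function.update_of_ne hji]
        exact h j (by have := Fin.val_ne_of_ne hji; omega)
  simp only [key, ite_and]
  simp

/-- The first `i` entries of the sequence are those of `u`, the others are `a`. -/
def extendTuple {α : Type*} (a : α) (N : ℕ) {i : ℕ} (u : Fin i → α) (j : Fin N) : α :=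
  if h : (j : ℕ) < i then u ⟨j, h⟩ else a

/-- Translates between histories grown by `Fin.snoc`, as in the moment bound, and full-length tuples
changed by `Function.update`, as in `conditionalStrategy`. -/
theorem extendTuple_snoc {α : Type*} (a : α) {N i : ℕ} (hi : i < N) (u : Fin i → α) (v : α) :
    extendTuple a N (Fin.snoc u v : Fin (i + 1) → α) =
      Function.update (extendTuple a N u) ⟨i, hi⟩ v := by
  ext j
  by_cases hj : j = ⟨i, hi⟩
  · subst hj; simp [extendTuple, Fin.snoc]
  · rw [Function.update_of_ne hj]
    have : (j : ℕ) ≠ i := fun h => hj (Fin.ext h)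
    by_cases hlt : (j : ℕ) < i
    · simp [extendTuple, Fin.snoc, hlt, Nat.lt_succ_of_lt hlt]
    · simp [extendTuple, hlt, show ¬ (j : ℕ) < i + 1 by omega]

theorem extendTuple_self {α : Type*} (a : α) {N : ℕ} (u : Fin N → α) :
    extendTuple a N u = u := by
  ext j
  simp [extendTuple]

/-- Once the output of round `i` is summed out, sequentiality erases its input `v`. -/
theorem IsSequential.sum_prefixOp_update {N : ℕ} {U T Q : Type*} [Fintype T]
    {F : (Fin N → U) → (Fin N → T) → Matrix Q Q ℂ} (hF : IsSequential F) (i : Fin N)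
    (u : Fin N → U) (t : Fin N → T) (v : U) :
    ∑ s, prefixOp F (i + 1) (Function.update u i v) (Function.update t i s) =
      prefixOp F i u t := by
  rw [sum_prefixOp_succ]
  refine hF i i.2.le _ _ _ fun j hj => Function.update_of_ne ?_ _ _
  rintro rfl
  exact lt_irrefl _ hj

/-! ### One-round bound and tail estimate -/

/-- Given the first `i` rounds, the expected score in the next round is at most the quantum
value. -/
theorem IsPartiteSequentialStrategy.conditional_expectedScore_le {r N : ℕ} {I O : Fin r → Type*}
    [∀ k, Fintype (I k)] [∀ k, Fintype (O k)] (H : NonlocalGame I O) {K : ℝ}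
    (hscore : ∀ u t, H.score u t ∈ Set.Icc (-K) K) {Q : Type*} [Fintype Q] [DecidableEq Q]
    {F : (Fin N → ∀ k, I k) → (Fin N → ∀ k, O k) → Matrix Q Q ℂ}
    (hF : IsPartiteSequentialStrategy F) {φ : Matrix Q Q ℂ} (hφ : φ.PosSemidef) (i : Fin N)
    (u : Fin N → ∀ k, I k) (t : Fin N → ∀ k, O k) :
    H.expectedScore
        (fun v s => prefixOp F (i + 1) (Function.update u i v) (Function.update t i s)) φ ≤
      quantumValue H * (prefixOp F i u t * φ).trace.re := by
  set A := prefixOp F i u t with hA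
  set B := fun v s => prefixOp F (i + 1) (Function.update u i v) (Function.update t i s) with hB
  have hBpos : ∀ v s, (B v s).PosSemidef := fun v s => posSemidef_prefixOp hF.measurement _ _ _
  have hBsum : ∀ v, ∑ s, B v s = A := hF.sequential.sum_prefixOp_update i u t
  by_cases h0 : A = 0
  · have hB0 : ∀ v s, B v s = 0 := fun v =>
      Matrix.PosSemidef.eq_zero_of_sum_eq_zero (hBpos v) (by rw [hBsum, h0])
    simp [Game.expectedScore, hB0, h0]
  obtain ⟨d, P, V, hP, -, hV⟩ := hF.partite i u t h0
  set S : Matrix Q Q ℂ := cfc Real.sqrt A with hS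
  have hSh : Sᴴ = S := (cfc_predicate Real.sqrt A : IsSelfAdjoint _)
  -- The unnormalized post-measurement state `√A φ √A`, carried by `V` to the tensor product
  -- register.
  set σ := (S * V)ᴴ * φ * (S * V) with hσ
  have hσpos : σ.PosSemidef := hφ.conjTranspose_mul_mul_same _
  have htr : ∀ v s, (B v s * φ).trace = (productStrategy P v s * σ).trace := by
    intro v s
    have h1 : S * conditionalStrategy F i u t v s * S = B v s :=
      sqrt_mul_invSqrt_conj (hBpos v) (hBsum v) s
    rw [hV] at h1
    rw [← h1, hσ, Matrix.conjTranspose_mul, hSh]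
    calc (S * (V * productStrategy P v s * Vᴴ) * S * φ).trace
        = ((S * V) * (productStrategy P v s * (Vᴴ * S * φ))).trace := by
          simp only [Matrix.mul_assoc]
      _ = _ := by rw [Matrix.trace_mul_comm]; simp only [Matrix.mul_assoc]
  have hv : ∀ _ : ∀ k, I k, σ.trace = (A * φ).trace := by
    intro v
    rw [← hBsum v, Finset.sum_mul, Matrix.trace_sum, Finset.sum_congr rfl fun s _ => htr v s,
      ← Matrix.trace_sum, ← Finset.sum_mul, (isMeasurementStrategy_productStrategy hP).2 v,
      Matrix.one_mul]
  -- Any input tuple would do here; it only serves to sum a measurement to `1`.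
  rw [← hv (u i)]
  refine le_of_eq_of_le ?_ (expectedScore_le_quantumValue_mul_trace H hscore hP hσpos)
  simp only [Game.expectedScore, htr]

/-- Exponential Markov inequality for the score of a strategy. -/
theorem Game.probScoreExceeds_le {U T Q : Type*} [Fintype U] [Fintype T] [Fintype Q]
    [DecidableEq Q] (G : Game U T) {F : U → T → Matrix Q Q ℂ} (hF : IsMeasurementStrategy F)
    {φ : Matrix Q Q ℂ} (hφ : φ.PosSemidef) {Z : U → T → ℝ} {c : ℝ}
    (hZ : ∀ u t, c < G.score u t → 0 ≤ Z u t) :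
    G.probScoreExceeds F φ c ≤
      ∑ u, ∑ t, G.dist u * (F u t * φ).trace.re * Real.exp (Z u t) := by
  classical
  have hn : ∀ u t, 0 ≤ G.dist u * (F u t * φ).trace.re := fun u t =>
    mul_nonneg (G.dist_nonneg u) ((hF.1 u t).trace_mul_re_nonneg hφ)
  unfold Game.probScoreExceeds
  refine Finset.sum_le_sum fun u _ => ?_
  rw [Finset.sum_filter]
  refine Finset.sum_le_sum fun t _ => ?_
  split_ifs with h
  · exact le_mul_of_one_le_right (hn u t) (Real.one_le_exp (hZ u t h))
  · exact mul_nonneg (hn u t) (Real.exp_nonneg _)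

theorem IsPartiteSequentialStrategy.sum_dist_mul_exp_le {r : ℕ} {I O : Fin r → Type*}
    [∀ k, Fintype (I k)] [∀ k, Fintype (O k)] (H : NonlocalGame I O) {K : ℝ} (hK : 0 < K)
    (hscore : ∀ u t, H.score u t ∈ Set.Icc (-K) K) {N : ℕ} {Q : Type*} [Fintype Q]
    [DecidableEq Q] {F : (Fin N → ∀ k, I k) → (Fin N → ∀ k, O k) → Matrix Q Q ℂ}
    {φ : Matrix Q Q ℂ} (hF : IsPartiteSequentialStrategy F) (hφ : IsState φ)
    (u₀ : ∀ k, I k) (t₀ : ∀ k, O k) {lam : ℝ} (hlam : 0 ≤ lam) :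
    ∑ u, ∑ t, (H.repeated N).dist u * (F u t * φ).trace.re *
        Real.exp (lam * ∑ j, (H.score (u j) (t j) - quantumValue H)) ≤
      Real.cosh (lam * (2 * K)) ^ N := by
  set G : (i : ℕ) → (Fin i → ∀ k, I k) → (Fin i → ∀ k, O k) → ℝ := fun i u t =>
    (prefixOp F i (extendTuple u₀ N u) (extendTuple t₀ N t) * φ).trace.re with hG
  have hω := abs_le.mp (abs_quantumValue_le H hscore hK.le)
  have hsum : ∀ i < N, ∀ u t v, ∑ s, G (i + 1) (Fin.snoc u v) (Fin.snoc t s) = G i u t := by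
    intro i hi u t v
    simp only [hG, extendTuple_snoc _ hi]
    rw [← Complex.re_sum, ← Matrix.trace_sum, ← Finset.sum_mul]
    exact congrArg (fun A => (A * φ).trace.re)
      (hF.sequential.sum_prefixOp_update ⟨i, hi⟩ (extendTuple u₀ N u) (extendTuple t₀ N t) v)
  have hmean : ∀ i < N, ∀ u t, ∑ v, ∑ s, H.dist v * G (i + 1) (Fin.snoc u v) (Fin.snoc t s) *
      (H.score v s - quantumValue H) ≤ 0 := by
    intro i hi u t
    have h := hF.conditional_expectedScore_le H hscore hφ.1 ⟨i, hi⟩ (extendTuple u₀ N u)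
      (extendTuple t₀ N t)
    have h2 : ∑ v, ∑ s, H.dist v * G (i + 1) (Fin.snoc u v) (Fin.snoc t s) * quantumValue H =
        quantumValue H * G i u t := by
      simp only [← Finset.sum_mul, ← Finset.mul_sum, hsum i hi, H.dist_sum]
      ring
    simp only [mul_sub, Finset.sum_sub_distrib, h2, sub_nonpos]
    simpa only [hG, extendTuple_snoc _ hi, Game.expectedScore] using h
  have hGn : ∀ i ≤ N, ∀ u t, 0 ≤ G i u t := fun i _ u t =>
    (posSemidef_prefixOp hF.measurement i _ _).trace_mul_re_nonneg hφ.1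
  have hY : ∀ v s, |H.score v s - quantumValue H| ≤ 2 * K := fun v s =>
    abs_le.mpr ⟨by linarith [(hscore v s).1], by linarith [(hscore v s).2]⟩
  have h := sum_prod_mul_exp_le H.dist_nonneg H.dist_sum
    (Y := fun v s => H.score v s - quantumValue H) (mul_pos two_pos hK) hY hGn hsum hmean hlam
    (le_refl N)
  have h0 : G 0 Fin.elim0 Fin.elim0 = 1 := by
    simp [hG, prefixOp_zero, hF.measurement.2, hφ.2]
  rw [h0, mul_one] at h
  simpa only [hG, extendTuple_self, prefixOp_self, Game.repeated] using h

theorem mainTheorem5 {r : ℕ} {I O : Fin r → Type*} [∀ k, Fintype (I k)] [∀ k, Fintype (O k)]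
    (H : NonlocalGame I O) (K : ℝ) (hK : 0 < K) (hscore : ∀ u t, H.score u t ∈ Set.Icc (-K) K)
    (N : ℕ) {Q : Type*} [Fintype Q] [DecidableEq Q]
    (F : (Fin N → ∀ k, I k) → (Fin N → ∀ k, O k) → Matrix Q Q ℂ) (φ : Matrix Q Q ℂ)
    (hF : IsPartiteSequentialStrategy F) (hφ : IsState φ) (δ : ℝ) (hδ : 0 ≤ δ) :
    (H.repeated N).probScoreExceeds F φ ((quantumValue H + δ) * N) ≤
      Real.exp (-(N * δ ^ 2) / (8 * K ^ 2)) := by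
  classical
  have hU : Nonempty (∀ k, I k) := by
    by_contra h
    rw [not_nonempty_iff] at h
    simpa using H.dist_sum
  obtain ⟨u₀⟩ := hU
  -- `t₀` is needed as padding for histories. Without output tuples the probability is an empty sum,
  -- or for `N = 0` the event reads `0 < 0`.
  rcases isEmpty_or_nonempty (∀ k, O k) with hT | ⟨⟨t₀⟩⟩
  · refine le_trans (le_of_eq ?_) (Real.exp_nonneg _)
    rcases Nat.eq_zero_or_pos N with rfl | hN
    · simp [Game.probScoreExceeds, Game.repeated]
    · have : Nonempty (Fin N) := ⟨⟨0, hN⟩⟩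
      simp [Game.probScoreExceeds]
  -- Since `cosh x ≤ exp (x ^ 2 / 2)`, the final exponent is `N * (2 * K ^ 2 * lam ^ 2 - lam * δ)`,
  -- which this `lam` minimizes.
  have hlam : 0 ≤ δ / (4 * K ^ 2) := by positivity
  set lam := δ / (4 * K ^ 2) with hlam_def
  have h1 := (H.repeated N).probScoreExceeds_le hF.measurement hφ.1
    (Z := fun u t => lam * ∑ j, (H.score (u j) (t j) - quantumValue H) - lam * (δ * N))
    (c := (quantumValue H + δ) * N) (by
      intro u t h
      simp only [Game.repeated] at h
      simp only [Finset.sum_sub_distrib, Finset.sum_const, Finset.card_univ, Fintype.card_fin,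
        nsmul_eq_mul, ← mul_sub]
      exact mul_nonneg hlam (by linarith))
  refine h1.trans ?_
  have h2 := hF.sum_dist_mul_exp_le H hK hscore hφ u₀ t₀ hlam
  simp only [sub_eq_add_neg (lam * _), Real.exp_add, ← mul_assoc, ← Finset.sum_mul]
  refine (mul_le_mul_of_nonneg_right h2 (Real.exp_nonneg _)).trans ?_
  refine (mul_le_mul_of_nonneg_right (pow_le_pow_left₀ (Real.cosh_pos _).le
    (Real.cosh_le_exp_half_sq _) N) (Real.exp_nonneg _)).trans_eq ?_
  rw [← Real.exp_nat_mul, ← Real.exp_add, hlam_def]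
  congr 1
  field_simp
  ring
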